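/- Let $c$ be the real Banach space of convergent real sequences $x=(x_n)_{n\ge 1}$ with the supremum norm. Let $K=\mathbb N\cup\{\infty\}$ be the one-point compactification of the discrete space $\mathbb N=\{1,2,\dots\}$, let $M(K)=C(K)^*$, let $\delta_k\in M(K)$ be the Dirac measure at $k\in K$, and identify $c$ with $C(K)$ by the isometric isomorphism under which $x\in c$ corresponds to the continuous function taking the value $x_n$ at each $n\in\mathbb N$ (and $\lim_n x_n$ at $\infty$). All spaces are real. A linear isometry $T\colon X\to Y$ between Banach spaces is a U-embedding if for every $x^*\in X^*$ with $\|x^*\|=1$ there is exactly one $y^*\in Y^*$ with $y^*\circ T=x^*$ and $\|y^*\|=\|x^*\|$. A Banach space is polyhedral if the closed unit ball of each of its finite-dimensional subspaces is a polytope (the convex hull of a finite set). Then $c$ is not polyhedral, and $c$ can be U-embedded into $C[0,1]$, that is, there is a U-embedding $T\colon c\to C[0,1]$. Moreover, $T$ can be chosen of the form $(Tx)(t)=\langle x,F(t)\rangle$, where $F\colon[0,1]\to B_{M(K)}$ is $w^*$-continuous, $F(0)=\delta_\infty$, $F(1/n)=\delta_n$ for every $n\ge1$, and where, for suitable $p_n\in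 M(K)$ with $\|p_n\|<1$, $F$ runs on each interval $[1/(n+1),1/n]$ along the quadratic Bézier curve with control points $\delta_{n+1}$, $p_n$, $\delta_n$: $$F\Big(\frac{1-s}{n+1}+\frac{s}{n}\Big)=(1-s)^2\,\delta_{n+1}+2s(1-s)\,p_n+s^2\,\delta_n\qquad(0\le s\le 1,\ n\ge 1).$$ -/

import Mathlib

open Set Filter Topology
open scoped BoundedContinuousFunction unitInterval

/-- The real Banach space `c` of convergent real sequences, with the supremum norm
(inherited from the space of all bounded sequences). -/
def ConvSeq : Submodule ℝ (ℕ →ᵇ ℝ) where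
  carrier := {x | ∃ L : ℝ, Tendsto (fun n => x n) atTop (𝓝 L)}
  add_mem' := by
    rintro x y ⟨L, hL⟩ ⟨M, hM⟩
    exact ⟨L + M, by simpa using hL.add hM⟩
  zero_mem' := ⟨0, by simp⟩
  smul_mem' := by
    rintro a x ⟨L, hL⟩
    exact ⟨a * L, by simpa using hL.const_mul a⟩

/-- A linear isometry `T : X → Y` is a *U-embedding* if every norm-one functional on `X` has a
unique Hahn-Banach (norm-preserving) extension through `T`. -/
def IsUEmbedding {X Y : Type*} [NormedAddCommGroup X] [NormedSpace ℝ X]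
    [NormedAddCommGroup Y] [NormedSpace ℝ Y] (T : X →ₗᵢ[ℝ] Y) : Prop :=
  ∀ φ : StrongDual ℝ X, ‖φ‖ = 1 →
    ∃! ψ : StrongDual ℝ Y, ψ.comp T.toContinuousLinearMap = φ ∧ ‖ψ‖ = ‖φ‖

/-- A real normed space is *polyhedral* (Klee) if the closed unit ball of each of its
finite-dimensional subspaces is a polytope, that is, the convex hull of a finite set. -/
def IsPolyhedralSpace (X : Type*) [NormedAddCommGroup X] [NormedSpace ℝ X] : Prop :=
  ∀ E : Submodule ℝ X, FiniteDimensional ℝ E →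
    ∃ V : Set E, V.Finite ∧ Metric.closedBall (0 : E) 1 = convexHull ℝ V

/-- The space `M(K) = C(K)*` of regular signed Borel measures on a compact space `K`, as the dual
of `C(K)`, normed by the dual norm (the total variation). -/
abbrev MeasureSpaceDual (K : Type*) [TopologicalSpace K] [CompactSpace K] : Type _ :=
  StrongDual ℝ C(K, ℝ)

/-- The Dirac measure at `k`, as an element of `M(K)`. -/
noncomputable def diracFunctional {K : Type*} [TopologicalSpace K] [CompactSpace K] (k : K) :
    MeasureSpaceDual K :=
  ContinuousMap.evalCLM ℝ k

/-- The quadratic Bézier curve with control points `a`, `b`, `c`, at the parameter `s ∈ [0, 1]`. -/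
def quadBezier {V : Type*} [AddCommGroup V] [Module ℝ V] (a b c : V) (s : ℝ) : V :=
  (1 - s) ^ 2 • a + (2 * s * (1 - s)) • b + s ^ 2 • c

/-! The functionals `F t` have norm at most `r t`, where `r ≤ 1` is continuous and equals 1 only on
the closed set S = {0} ∪ {1/(n+1)}. On S the curve consists of the Dirac measures, so `T x`
restricted to S is `x` itself, and every continuous function on [0,1] agrees on S with some `T x`. A
norm-preserving extension `ψ` must vanish on each `g` that is zero on S: off S, `T x` stays below
`r` in modulus, which leaves room to add a small multiple of `±g` to a nearly norming `T x`
(`apply_nonpos_of_norm_preserving_extension`). Hence `ψ g = φ x` whenever `g = T x` on S, and `ψ` is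
unique (`isUEmbedding_of_norm_le`).

For non-polyhedrality, the polynomials aθ + bθ² restricted to a convergent sequence of distinct
points form a plane in `c`. Every coordinate reaches the value 1 on its unit ball, while no single
element takes the value 1 at three coordinates, so finitely many vertices cannot suffice. -/

/-! ### Gluing a sequence of curves along the points `1 / (n + 1)` -/

/-- The curve on `[0, 1]` that starts at `a` and runs through `γ n`, at the affine parameter in
`[0, 1]`, on the interval `[1 / (n + 2), 1 / (n + 1)]`. -/
noncomputable def glueCurves {X : Type*} (a : X) (γ : ℕ → ℝ → X) (t : I) : X :=
  if (t : ℝ) = 0 then a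
  else γ (⌊1 / (t : ℝ)⌋₊ - 1)
    ((((⌊1 / (t : ℝ)⌋₊ - 1 : ℕ) : ℝ) + 1) * ((((⌊1 / (t : ℝ)⌋₊ - 1 : ℕ) : ℝ) + 2) * t - 1))

theorem glueCurves_zero {X : Type*} (a : X) (γ : ℕ → ℝ → X) : glueCurves a γ 0 = a := by
  simp [glueCurves]

theorem map_glueCurves {X Y : Type*} (f : X → Y) (a : X) (γ : ℕ → ℝ → X) (t : I) :
    f (glueCurves a γ t) = glueCurves (f a) (fun n s => f (γ n s)) t := by
  unfold glueCurves
  split_ifs <;> rfl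

theorem affine_param_iff (n : ℕ) (t s : ℝ) :
    t = (1 - s) * (1 / ((n : ℝ) + 2)) + s * (1 / ((n : ℝ) + 1)) ↔
      s = ((n : ℝ) + 1) * (((n : ℝ) + 2) * t - 1) := by
  have h1 : (n : ℝ) + 1 ≠ 0 := by positivity
  have h2 : (n : ℝ) + 2 ≠ 0 := by positivity
  constructor
  · rintro rfl
    field_simp
    ring
  · rintro rfl
    field_simp
    ring

theorem affine_param_mem_Icc {n : ℕ} {t : ℝ} (h1 : 1 / ((n : ℝ) + 2) ≤ t)
    (h2 : t ≤ 1 / ((n : ℝ) + 1)) :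
    ((n : ℝ) + 1) * (((n : ℝ) + 2) * t - 1) ∈ Icc (0 : ℝ) 1 := by
  have hn : (0 : ℝ) ≤ n := n.cast_nonneg
  rw [div_le_iff₀ (by positivity)] at h1
  rw [le_div_iff₀ (by positivity)] at h2
  constructor
  · exact mul_nonneg (by positivity) (by linarith)
  · nlinarith

/-- Every `t ∈ (0, 1]` lies on one of the intervals `[1 / (n + 2), 1 / (n + 1)]`. -/
theorem exists_affine_param {t : I} (ht : (t : ℝ) ≠ 0) :
    ∃ n : ℕ, n = ⌊1 / (t : ℝ)⌋₊ - 1 ∧ 1 / ((n : ℝ) + 2) ≤ t ∧ (t : ℝ) ≤ 1 / ((n : ℝ) + 1) := by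
  have h0 : (0 : ℝ) < t := lt_of_le_of_ne t.2.1 (Ne.symm ht)
  have h1 : 1 ≤ 1 / (t : ℝ) := by rw [le_div_iff₀ h0]; linarith [t.2.2]
  have hm : 1 ≤ ⌊1 / (t : ℝ)⌋₊ := Nat.le_floor (by simpa using h1)
  obtain ⟨n, hn⟩ := Nat.exists_eq_add_of_le' hm
  have hle := Nat.floor_le (zero_le_one.trans h1)
  have hlt := Nat.lt_floor_add_one (1 / (t : ℝ))
  rw [hn] at hle hlt
  push_cast at hle hlt
  refine ⟨n, by omega, ?_, ?_⟩
  · rw [div_le_iff₀ (by positivity)]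
    rw [div_lt_iff₀ h0] at hlt
    linarith
  · rw [le_div_iff₀ (by positivity)]
    rw [le_div_iff₀ h0] at hle
    linarith

/-- A point of the glued curve is `a` or a point of one of the curves `γ n`. -/
theorem glueCurves_cases {X : Type*} (a : X) (γ : ℕ → ℝ → X) (t : I) :
    (t = 0 ∧ glueCurves a γ t = a) ∨
      ∃ (n : ℕ) (s : ℝ), s ∈ Icc (0 : ℝ) 1 ∧
        (t : ℝ) = (1 - s) * (1 / ((n : ℝ) + 2)) + s * (1 / ((n : ℝ) + 1)) ∧
        glueCurves a γ t = γ n s := by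
  by_cases ht : (t : ℝ) = 0
  · exact Or.inl ⟨Subtype.ext ht, by simp [glueCurves, ht]⟩
  · obtain ⟨n, hn, h1, h2⟩ := exists_affine_param ht
    refine Or.inr ⟨n, _, affine_param_mem_Icc h1 h2, (affine_param_iff n t _).2 rfl, ?_⟩
    rw [glueCurves, if_neg ht, ← hn]

theorem glueCurves_eq {X : Type*} {a : X} {γ : ℕ → ℝ → X} (hγ : ∀ n, γ n 0 = γ (n + 1) 1)
    {n : ℕ} {t : I} {s : ℝ} (hs : s ∈ Icc (0 : ℝ) 1)
    (ht : (t : ℝ) = (1 - s) * (1 / ((n : ℝ) + 2)) + s * (1 / ((n : ℝ) + 1))) :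
    glueCurves a γ t = γ n s := by
  have hn : (0 : ℝ) ≤ n := n.cast_nonneg
  have hst := (affine_param_iff n t s).1 ht
  rcases hs.1.eq_or_lt with h0 | h0
  -- At the shared endpoint 1/(n+2) the floor selects piece n+1 at its parameter 1, so the matching
  -- condition `hγ` is needed.
  · subst h0
    have ht' : (t : ℝ) = 1 / ((n : ℝ) + 2) := by simpa using ht
    have hne : (t : ℝ) ≠ 0 := by rw [ht']; positivity
    have hfl : ⌊1 / (t : ℝ)⌋₊ = n + 2 := by
      rw [ht', one_div_one_div]
      exact_mod_cast Nat.floor_natCast (R := ℝ) (n + 2)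
    rw [glueCurves, if_neg hne, hfl, hγ n]
    have : n + 2 - 1 = n + 1 := rfl
    rw [this]
    congr 1
    rw [ht']
    push_cast
    field_simp
    ring
  · have h1 : 1 < ((n : ℝ) + 2) * t := by
      by_contra! h
      have := mul_nonneg (by positivity : (0 : ℝ) ≤ n + 1) (sub_nonneg.2 h)
      linarith
    have htpos : (0 : ℝ) < t := by
      by_contra! h
      have := mul_nonneg (by positivity : (0 : ℝ) ≤ n + 2) (sub_nonneg.2 h)
      linarith
    have h2 : ((n : ℝ) + 1) * t ≤ 1 := by
      by_contra! h
      have h3 := hs.2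
      rw [hst] at h3
      nlinarith
    have hfl : ⌊1 / (t : ℝ)⌋₊ = n + 1 := by
      rw [Nat.floor_eq_iff (by positivity), le_div_iff₀ htpos, div_lt_iff₀ htpos]
      push_cast
      exact ⟨h2, by linarith⟩
    rw [glueCurves, if_neg htpos.ne', hfl, hst]
    rfl

/-- Away from 0 only finitely many closed pieces matter, and they agree at common endpoints; at 0,
`hlim` makes whole pieces converge to `a`. -/
theorem continuous_glueCurves {X : Type*} [TopologicalSpace X] {a : X} {γ : ℕ → ℝ → X}
    (hγ : ∀ n, γ n 0 = γ (n + 1) 1) (hc : ∀ n, Continuous (γ n))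
    (hlim : ∀ U ∈ 𝓝 a, ∀ᶠ n in atTop, ∀ s ∈ Icc (0 : ℝ) 1, γ n s ∈ U) :
    Continuous (glueCurves a γ) := by
  have hpiece (n : ℕ) : ContinuousOn (glueCurves a γ)
      {t : I | 1 / ((n : ℝ) + 2) ≤ t ∧ (t : ℝ) ≤ 1 / ((n : ℝ) + 1)} := by
    have : Continuous fun t : I => γ n (((n : ℝ) + 1) * (((n : ℝ) + 2) * t - 1)) :=
      (hc n).comp (by fun_prop)
    refine this.continuousOn.congr fun t ht => ?_
    exact glueCurves_eq hγ (affine_param_mem_Icc ht.1 ht.2) ((affine_param_iff n t _).2 rfl)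
  have htail (n : ℕ) : ContinuousOn (glueCurves a γ) {t : I | 1 / ((n : ℝ) + 1) ≤ t} := by
    induction n with
    | zero =>
      have : {t : I | 1 / (((0 : ℕ) : ℝ) + 1) ≤ t} = {1} := by
        ext t
        simp only [Nat.cast_zero, zero_add, div_one, mem_ofPred_eq, mem_singleton_iff]
        exact ⟨fun h => Subtype.ext (le_antisymm t.2.2 h), fun h => by simp [h]⟩
      rw [this]
      exact continuousOn_singleton _ _
    | succ n ih =>
      have hle : 1 / ((n : ℝ) + 2) ≤ 1 / ((n : ℝ) + 1) := by gcongr; norm_num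
      refine ((hpiece n).union_of_isClosed ih ?_ ?_).mono fun t ht => ?_
      · exact (isClosed_le continuous_const continuous_subtype_val).inter
          (isClosed_le continuous_subtype_val continuous_const)
      · exact isClosed_le continuous_const continuous_subtype_val
      · have ht' : 1 / ((n : ℝ) + 2) ≤ t := by
          have h := ht
          simp only [mem_ofPred_eq, Nat.cast_add, Nat.cast_one] at h
          rwa [add_assoc, one_add_one_eq_two] at h
        exact (le_total (t : ℝ) (1 / ((n : ℝ) + 1))).imp (fun h => ⟨ht', h⟩) id
  rw [continuous_iff_continuousAt]
  intro t
  rcases eq_or_lt_of_le t.2.1 with h0 | h0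
  · obtain rfl : t = 0 := Subtype.ext h0.symm
    intro U hU
    rw [glueCurves_zero] at hU
    obtain ⟨N, hN⟩ := eventually_atTop.1 (hlim U hU)
    have hmem : {t : I | (t : ℝ) < 1 / ((N : ℝ) + 1)} ∈ 𝓝 (0 : I) :=
      (isOpen_lt continuous_subtype_val continuous_const).mem_nhds
        (show ((0 : I) : ℝ) < 1 / ((N : ℝ) + 1) by simp only [Icc.coe_zero]; positivity)
    rw [mem_map]
    filter_upwards [hmem] with t ht
    rw [mem_preimage]
    by_cases ht0 : (t : ℝ) = 0
    · obtain rfl : t = 0 := Subtype.ext ht0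
      rw [glueCurves_zero]
      exact mem_of_mem_nhds hU
    obtain ⟨n, -, h1, h2⟩ := exists_affine_param ht0
    rw [glueCurves_eq hγ (affine_param_mem_Icc h1 h2) ((affine_param_iff n t _).2 rfl)]
    refine hN n ?_ _ (affine_param_mem_Icc h1 h2)
    have h3 := h1.trans_lt ht
    rw [one_div_lt_one_div (by positivity) (by positivity)] at h3
    have h4 : N < n + 1 := by exact_mod_cast (by linarith : (N : ℝ) < n + 1)
    omega
  · obtain ⟨N, hN⟩ := exists_nat_one_div_lt h0
    exact (htail N).continuousAt (mem_of_superset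
      ((isOpen_lt continuous_const continuous_subtype_val).mem_nhds hN)
      fun u (hu : 1 / ((N : ℝ) + 1) < u) => hu.le)

/-! ### A criterion for U-embeddings into spaces of continuous functions -/

section UEmbedding

variable {X K : Type*} [NormedAddCommGroup X] [NormedSpace ℝ X] [TopologicalSpace K]
  [CompactSpace K]

/-- A continuous function that vanishes where `r = 1` is bounded by a multiple of `1 - r`, up to an
arbitrarily small error. -/
theorem exists_abs_le_add_mul_one_sub {r : K → ℝ} (hr : Continuous r) (hr1 : ∀ t, r t ≤ 1)
    {g : C(K, ℝ)} (hg : ∀ t, r t = 1 → g t = 0) {ε : ℝ} (hε : 0 < ε) :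
    ∃ C > 0, ∀ t, |g t| ≤ ε + C * (1 - r t) := by
  have hK : IsCompact {t | ε ≤ |g t|} :=
    (isClosed_le continuous_const g.continuous.abs).isCompact
  obtain ⟨δ, hδ, hmin⟩ := hK.exists_forall_le' (f := fun t => 1 - r t) (a := 0)
    (by fun_prop) fun t ht => by
      have h : r t ≠ 1 := fun h => by
        rw [mem_ofPred_eq, hg t h, abs_zero] at ht
        linarith
      linarith [lt_of_le_of_ne (hr1 t) h]
  -- The summand 1 keeps the constant positive when `g = 0`; it is inverted later.
  refine ⟨(‖g‖ + 1) / δ, by positivity, fun t => ?_⟩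
  rcases le_or_gt ε |g t| with h | h
  · have h1 : ‖g‖ + 1 ≤ (‖g‖ + 1) / δ * (1 - r t) := by
      rw [div_mul_eq_mul_div, le_div_iff₀ hδ]
      exact mul_le_mul_of_nonneg_left (hmin t h) (by positivity)
    have h2 : |g t| ≤ ‖g‖ := g.norm_coe_le_norm t
    linarith
  · have : 0 ≤ (‖g‖ + 1) / δ * (1 - r t) := mul_nonneg (by positivity) (sub_nonneg.2 (hr1 t))
    linarith

/-- Up to a small error, `C⁻¹ |g|` fits into the gap `1 - r` that `T x` leaves below 1. The sum
therefore has norm about 1, and as `ψ (T x)` is already close to 1, nothing is left for `ψ g`. -/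
theorem apply_nonpos_of_norm_preserving_extension {T : X →ₗᵢ[ℝ] C(K, ℝ)} {r : K → ℝ}
    (hr : Continuous r) (hr0 : ∀ t, 0 ≤ r t) (hr1 : ∀ t, r t ≤ 1)
    (hT : ∀ x t, |T x t| ≤ r t * ‖x‖)
    {φ : StrongDual ℝ X} (hφ : ‖φ‖ = 1) {ψ : StrongDual ℝ C(K, ℝ)}
    (hψφ : ψ.comp T.toContinuousLinearMap = φ) (hψ : ‖ψ‖ = 1) {g : C(K, ℝ)}
    (hg : ∀ t, r t = 1 → g t = 0) : ψ g ≤ 0 := by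
  refine le_of_forall_pos_le_add fun ε hε => ?_
  obtain ⟨C, hC, hgC⟩ := exists_abs_le_add_mul_one_sub hr hr1 hg (half_pos hε)
  -- `φ` need not attain its norm, so `x` is only nearly norming; `C` is fixed before `δ` tends to
  -- 0.
  have key : ∀ δ > 0, C⁻¹ * ψ g ≤ C⁻¹ * (ε / 2) + δ := by
    intro δ hδ
    obtain ⟨x, hx, hxφ⟩ : ∃ x : X, ‖x‖ < 1 ∧ 1 - δ < φ x := by
      obtain ⟨x, hx, h⟩ := φ.exists_lt_apply_of_lt_opNorm (by linarith : 1 - δ < ‖φ‖)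
      rcases lt_abs.1 h with h | h
      · exact ⟨x, hx, h⟩
      · exact ⟨-x, by rwa [norm_neg], by rwa [map_neg]⟩
    have hnorm : ‖T x + C⁻¹ • g‖ ≤ 1 + C⁻¹ * (ε / 2) := by
      rw [ContinuousMap.norm_le _ (by positivity)]
      intro t
      have hTr : |T x t| ≤ r t :=
        (hT x t).trans (mul_le_of_le_one_right (hr0 t) hx.le)
      have h2 : C⁻¹ * |g t| ≤ C⁻¹ * (ε / 2) + (1 - r t) := by
        calc C⁻¹ * |g t| ≤ C⁻¹ * (ε / 2 + C * (1 - r t)) := by gcongr; exact hgC t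
          _ = _ := by field_simp
      calc ‖(T x + C⁻¹ • g) t‖ = |T x t + C⁻¹ * g t| := rfl
        _ ≤ |T x t| + |C⁻¹ * g t| := abs_add_le _ _
        _ = |T x t| + C⁻¹ * |g t| := by rw [abs_mul, abs_of_pos (inv_pos.2 hC)]
        _ ≤ 1 + C⁻¹ * (ε / 2) := by linarith
    have h1 : ψ (T x + C⁻¹ • g) ≤ 1 + C⁻¹ * (ε / 2) :=
      (le_abs_self _).trans ((ψ.le_of_opNorm_le hψ.le _).trans (by rwa [one_mul]))
    have h2 : ψ (T x) = φ x := by rw [← hψφ]; rfl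
    rw [map_add, map_smul, h2, smul_eq_mul] at h1
    linarith
  have := le_of_mul_le_mul_left (le_of_forall_pos_le_add key) (inv_pos.2 hC)
  linarith

/-- `T : X → C(K)` is a U-embedding if the functionals `x ↦ T x t` have norm at most `r t` for a
continuous `r ≤ 1`, and every continuous function agrees with some `T x` where `r = 1`. -/
theorem isUEmbedding_of_norm_le {T : X →ₗᵢ[ℝ] C(K, ℝ)} {r : K → ℝ}
    (hr : Continuous r) (hr0 : ∀ t, 0 ≤ r t) (hr1 : ∀ t, r t ≤ 1)
    (hT : ∀ x t, |T x t| ≤ r t * ‖x‖)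
    (hsurj : ∀ g : C(K, ℝ), ∃ x, ∀ t, r t = 1 → T x t = g t) : IsUEmbedding T := by
  intro φ hφ
  have huniq {ψ : StrongDual ℝ C(K, ℝ)} (h1 : ψ.comp T.toContinuousLinearMap = φ)
      (h2 : ‖ψ‖ = ‖φ‖) {g : C(K, ℝ)} {x : X} (hx : ∀ t, r t = 1 → T x t = g t) :
      ψ g = φ x := by
    have ha := apply_nonpos_of_norm_preserving_extension hr hr0 hr1 hT hφ h1 (h2.trans hφ)
      (g := g - T x) fun t ht => by simp [hx t ht]
    have hb := apply_nonpos_of_norm_preserving_extension hr hr0 hr1 hT hφ h1 (h2.trans hφ)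
      (g := T x - g) fun t ht => by simp [hx t ht]
    have h3 : ψ (T x) = φ x := by rw [← h1]; rfl
    rw [map_sub] at ha hb
    linarith
  obtain ⟨ψ, hψ, hn⟩ := exists_extension_norm_eq (LinearMap.range T.toLinearMap)
    (φ.comp (T.equivRange.symm.toContinuousLinearEquiv : _ →L[ℝ] X))
  have hφψ : ψ.comp T.toContinuousLinearMap = φ := by
    ext x
    have h := hψ (T.equivRange x)
    simpa using h
  have hψn : ‖ψ‖ = ‖φ‖ := by
    refine le_antisymm ?_ ?_
    · rw [hn]
      refine ContinuousLinearMap.opNorm_le_bound _ (norm_nonneg _) fun y => ?_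
      refine (φ.le_opNorm _).trans_eq ?_
      congr 1
      exact T.equivRange.symm.norm_map y
    · refine ContinuousLinearMap.opNorm_le_bound _ (norm_nonneg _) fun x => ?_
      rw [← hφψ]
      exact (ψ.le_opNorm _).trans_eq (by simp)
  refine ⟨ψ, ⟨hφψ, hψn⟩, ?_⟩
  rintro ψ' ⟨h1, h2⟩
  ext g
  obtain ⟨x, hx⟩ := hsurj g
  rw [huniq h1 h2 hx, huniq hφψ hψn hx]

end UEmbedding

/-! ### The space `c` is not polyhedral -/

theorem tendsto_one_add_one_div : Tendsto (fun n : ℕ => 1 + 1 / ((n : ℝ) + 1)) atTop (𝓝 1) := by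
  simpa using tendsto_one_div_add_atTop_nhds_zero_nat.const_add (1 : ℝ)

/-- A convergent real sequence as an element of `c`. -/
noncomputable def ConvSeq.ofTendsto (f : ℕ → ℝ) (L : ℝ) (h : Tendsto f atTop (𝓝 L)) : ConvSeq :=
  ⟨BoundedContinuousFunction.ofNormedAddCommGroupDiscrete f
      h.norm.bddAbove_range.choose
      (fun n => h.norm.bddAbove_range.choose_spec ⟨n, rfl⟩), L, h⟩

theorem ConvSeq.norm_le {x : ConvSeq} {C : ℝ} (hC : 0 ≤ C) : ‖x‖ ≤ C ↔ ∀ n, |x.1 n| ≤ C :=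
  BoundedContinuousFunction.norm_le hC

theorem ConvSeq.abs_apply_le (x : ConvSeq) (n : ℕ) : |x.1 n| ≤ ‖x‖ :=
  (ConvSeq.norm_le (norm_nonneg x)).1 le_rfl n

theorem not_eq_one_at_three_points {a b p q r : ℝ} (hpq : p ≠ q) (hpr : p ≠ r) (hqr : q ≠ r)
    (hp : a * p + b * p ^ 2 = 1) (hq : a * q + b * q ^ 2 = 1) (hr : a * r + b * r ^ 2 = 1) :
    False := by
  have h1 : a + b * (p + q) = 0 := by
    apply mul_left_cancel₀ (sub_ne_zero.2 hpq)
    linear_combination hp - hq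
  have h2 : a + b * (p + r) = 0 := by
    apply mul_left_cancel₀ (sub_ne_zero.2 hpr)
    linear_combination hp - hr
  have hb : b = 0 := by
    apply mul_left_cancel₀ (sub_ne_zero.2 hqr)
    linear_combination h1 - h2
  have ha : a = 0 := by simpa [hb] using h1
  simp [ha, hb] at hp

/-- The plane spanned by `θ` and `θ ^ 2`, where `θ n = 1 + 1 / (n + 1)`, has infinitely many
faces. -/
theorem not_isPolyhedralSpace_convSeq : ¬ IsPolyhedralSpace ConvSeq := by
  intro hpoly
  set θ : ℕ → ℝ := fun n => 1 + 1 / ((n : ℝ) + 1) with hθdef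
  have hθ : Tendsto θ atTop (𝓝 1) := tendsto_one_add_one_div
  have hθ1 (n : ℕ) : 1 ≤ θ n := by simp only [hθdef, le_add_iff_nonneg_right]; positivity
  have hθ2 (n : ℕ) : θ n ≤ 2 := by
    have : 1 / ((n : ℝ) + 1) ≤ 1 := by
      rw [div_le_one (by positivity)]; linarith [n.cast_nonneg (α := ℝ)]
    simp only [hθdef]; linarith
  have hθinj {m n : ℕ} (h : m ≠ n) : θ m ≠ θ n := by
    intro heq
    simp only [hθdef, add_right_inj, one_div, inv_inj, add_left_inj, Nat.cast_inj] at heq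
    exact h heq
  let u : ConvSeq := ConvSeq.ofTendsto θ 1 hθ
  let v : ConvSeq := ConvSeq.ofTendsto (fun n => θ n ^ 2) 1 (by simpa using hθ.pow 2)
  let E : Submodule ℝ ConvSeq := Submodule.span ℝ {u, v}
  obtain ⟨V, hVfin, hV⟩ := hpoly E (FiniteDimensional.span_of_finite ℝ (by simp))
  have hform (w : E) : ∃ a b : ℝ, ∀ n, w.1.1 n = a * θ n + b * θ n ^ 2 := by
    obtain ⟨a, b, h⟩ := Submodule.mem_span_pair.1 w.2
    exact ⟨a, b, fun n => by rw [← h]; rfl⟩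
  have hball (w : E) : w ∈ Metric.closedBall (0 : E) 1 ↔ ‖w.1‖ ≤ 1 := by
    rw [Metric.mem_closedBall, Subtype.dist_eq, Submodule.coe_zero]
    exact iff_of_eq (congrArg (fun d => d ≤ (1 : ℝ)) (dist_zero_right w.1))
  have hle {w : E} (hw : w ∈ V) (n : ℕ) : w.1.1 n ≤ 1 := by
    have h1 : w ∈ Metric.closedBall (0 : E) 1 := hV ▸ subset_convexHull ℝ V hw
    have h2 : ‖w.1‖ ≤ 1 := (hball w).1 h1
    exact (le_abs_self _).trans ((ConvSeq.abs_apply_le w.1 n).trans h2)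
  have hex (n : ℕ) : ∃ w : V, w.1.1.1 n = 1 := by
    by_contra! hne
    have hn0 : θ n ≠ 0 := by linarith [hθ1 n]
    -- This is the parabola through the origin with its maximum 1 at θ n. As the ratios θ m / θ n
    -- lie in [0, 2], it stays in [0, 1].
    let z : E := ⟨(2 / θ n) • u + (-(1 / θ n ^ 2)) • v, Submodule.mem_span_pair.2 ⟨_, _, rfl⟩⟩
    have hz (m : ℕ) : z.1.1 m = 1 - (θ m / θ n - 1) ^ 2 := by
      have : z.1.1 m = (2 / θ n) * θ m + (-(1 / θ n ^ 2)) * θ m ^ 2 := rfl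
      rw [this]
      field_simp
      ring
    have hzball : z ∈ Metric.closedBall (0 : E) 1 := by
      rw [hball, ConvSeq.norm_le zero_le_one]
      intro m
      have h0 : 0 < θ n := by linarith [hθ1 n]
      have h1 : 0 ≤ θ m / θ n := div_nonneg (by linarith [hθ1 m]) h0.le
      have h2 : θ m / θ n ≤ 2 := by
        rw [div_le_iff₀ h0]; linarith [hθ1 n, hθ2 m]
      rw [hz, abs_le]
      constructor <;> nlinarith
    rw [hV] at hzball
    -- If all vertices lay in this open half-space, so would the whole ball, contrary to `z n = 1`.
    have hconv : Convex ℝ {w : E | w.1.1 n < 1} := by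
      intro w hw w' hw' a b ha hb hab
      change a * w.1.1 n + b * w'.1.1 n < 1
      have h1 : w.1.1 n < 1 := hw
      have h2 : w'.1.1 n < 1 := hw'
      rcases ha.eq_or_lt with rfl | ha
      · obtain rfl : b = 1 := by linarith
        linarith
      · nlinarith
    have hlt : z.1.1 n < 1 :=
      convexHull_min (fun w hw => lt_of_le_of_ne (hle hw n) (hne ⟨w, hw⟩)) hconv hzball
    rw [hz, div_self hn0] at hlt
    norm_num at hlt
  choose w hw using hex
  have : Finite V := hVfin
  -- Pigeonhole: one vertex takes the value 1 at infinitely many coordinates; three are enough for a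
  -- contradiction.
  obtain ⟨w₀, hinf⟩ := Finite.exists_infinite_fiber w
  have hinf' : (w ⁻¹' {w₀}).Infinite := infinite_coe_iff.1 hinf
  obtain ⟨i, hi, -⟩ := hinf'.exists_gt 0
  obtain ⟨j, hj, hij⟩ := hinf'.exists_gt i
  obtain ⟨k, hk, hjk⟩ := hinf'.exists_gt j
  obtain ⟨a, b, hab⟩ := hform w₀.1
  have hone {n : ℕ} (hn : n ∈ w ⁻¹' {w₀}) : a * θ n + b * θ n ^ 2 = 1 := by
    rw [← hab n, ← hw n, show w n = w₀ from hn]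
  exact not_eq_one_at_three_points (hθinj hij.ne) (hθinj (hij.trans hjk).ne) (hθinj hjk.ne)
    (hone hi) (hone hj) (hone hk)

/-! ### Bézier curves -/

theorem quadBezier_zero {V : Type*} [AddCommGroup V] [Module ℝ V] (a b c : V) :
    quadBezier a b c 0 = a := by
  simp [quadBezier]

theorem quadBezier_one {V : Type*} [AddCommGroup V] [Module ℝ V] (a b c : V) :
    quadBezier a b c 1 = c := by
  simp [quadBezier]

theorem continuous_quadBezier {V : Type*} [NormedAddCommGroup V] [NormedSpace ℝ V] (a b c : V) :
    Continuous (quadBezier a b c) := by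
  unfold quadBezier
  fun_prop

theorem norm_quadBezier_le {V : Type*} [NormedAddCommGroup V] [NormedSpace ℝ V] {a b c : V}
    {A B C s : ℝ} (ha : ‖a‖ ≤ A) (hb : ‖b‖ ≤ B) (hc : ‖c‖ ≤ C) (hs : s ∈ Icc (0 : ℝ) 1) :
    ‖quadBezier a b c s‖ ≤ quadBezier A B C s := by
  have h1 : 0 ≤ 2 * s * (1 - s) :=
    mul_nonneg (mul_nonneg zero_le_two hs.1) (sub_nonneg.2 hs.2)
  refine (norm_add₃_le).trans ?_
  rw [norm_smul, norm_smul, norm_smul, Real.norm_of_nonneg (sq_nonneg _),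
    Real.norm_of_nonneg h1, Real.norm_of_nonneg (sq_nonneg _)]
  simp only [quadBezier, smul_eq_mul]
  gcongr

/-- The Bézier curves through a convergent sequence, with control points of the same limit, form a
continuous curve. -/
theorem continuous_glueCurves_quadBezier {V : Type*} [NormedAddCommGroup V] [NormedSpace ℝ V]
    {a b : ℕ → V} {L : V} (ha : Tendsto a atTop (𝓝 L)) (hb : Tendsto b atTop (𝓝 L)) :
    Continuous (glueCurves L fun n => quadBezier (a (n + 1)) (b n) (a n)) := by
  refine continuous_glueCurves (fun n => by rw [quadBezier_zero, quadBezier_one])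
    (fun n => continuous_quadBezier _ _ _) fun U hU => ?_
  obtain ⟨ε, hε, hεU⟩ := Metric.nhds_basis_closedBall.mem_iff.1 hU
  have hball := Metric.closedBall_mem_nhds L hε
  filter_upwards [ha.eventually_mem hball,
    ((tendsto_add_atTop_iff_nat 1).2 ha).eventually_mem hball,
    hb.eventually_mem hball] with n h1 h2 h3 s hs
  rw [mem_closedBall_iff_norm] at h1 h2 h3
  refine hεU (mem_closedBall_iff_norm.2 ?_)
  -- The Bernstein weights sum to 1, so `L` can be subtracted from each control point.
  have h4 : quadBezier (a (n + 1)) (b n) (a n) s - L =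
      quadBezier (a (n + 1) - L) (b n - L) (a n - L) s := by
    unfold quadBezier
    module
  rw [h4]
  refine (norm_quadBezier_le h2 h3 h1 hs).trans_eq ?_
  simp only [quadBezier, smul_eq_mul]
  ring

/-! ### The identification of `c` with `C(ℕ ∪ {∞})` -/

theorem tendsto_apply_infty (f : C(OnePoint ℕ, ℝ)) :
    Tendsto (fun n : ℕ => f (n : OnePoint ℕ)) atTop (𝓝 (f OnePoint.infty)) :=
  (OnePoint.continuous_iff_from_nat f).1 f.continuous

/-- A continuous function on `ℕ ∪ {∞}`, restricted to `ℕ`. -/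
noncomputable def restrictToNat : C(OnePoint ℕ, ℝ) →ₗᵢ[ℝ] ConvSeq where
  toFun f := ConvSeq.ofTendsto (fun n => f (n : OnePoint ℕ)) (f OnePoint.infty)
    (tendsto_apply_infty f)
  map_add' _ _ := rfl
  map_smul' _ _ := rfl
  norm_map' f := by
    apply le_antisymm
    · rw [ConvSeq.norm_le (norm_nonneg f)]
      exact fun n => f.norm_coe_le_norm n
    · refine (ContinuousMap.norm_le f (norm_nonneg (E := ConvSeq) _)).2 ?_
      have hn (n : ℕ) := ConvSeq.abs_apply_le (ConvSeq.ofTendsto _ _ (tendsto_apply_infty f)) n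
      intro k
      induction k using OnePoint.rec with
      | infty => exact le_of_tendsto' (tendsto_apply_infty f).norm hn
      | coe n => exact hn n

theorem restrictToNat_surjective : Function.Surjective restrictToNat := by
  rintro ⟨x, L, hx⟩
  refine ⟨OnePoint.continuousMapMkNat x L hx, Subtype.ext ?_⟩
  ext n
  rfl

/-- The canonical isometric isomorphism of `c` with `C(ℕ ∪ {∞})`. -/
noncomputable def convSeqEquiv : ConvSeq ≃ₗᵢ[ℝ] C(OnePoint ℕ, ℝ) :=
  (LinearIsometryEquiv.ofSurjective restrictToNat restrictToNat_surjective).symm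

theorem convSeqEquiv_restrictToNat (f : C(OnePoint ℕ, ℝ)) :
    convSeqEquiv (restrictToNat f) = f :=
  (LinearIsometryEquiv.ofSurjective restrictToNat restrictToNat_surjective).symm_apply_apply f

theorem convSeqEquiv_apply (x : ConvSeq) (n : ℕ) : convSeqEquiv x (n : OnePoint ℕ) = x.1 n := by
  obtain ⟨f, rfl⟩ := restrictToNat_surjective x
  rw [convSeqEquiv_restrictToNat]
  rfl

/-! ### The curve of measures -/

theorem norm_diracFunctional_le {K : Type*} [TopologicalSpace K] [CompactSpace K] (k : K) :
    ‖(diracFunctional k : MeasureSpaceDual K)‖ ≤ 1 :=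
  ContinuousLinearMap.opNorm_le_bound _ zero_le_one fun f => by
    rw [one_mul]
    exact f.norm_coe_le_norm k

/-- The weight at `δ_n` of the middle control point between `δ_{n+1}` and `δ_n`. -/
noncomputable def controlWeight (n : ℕ) : ℝ := 1 - 1 / ((n : ℝ) + 2)

theorem controlWeight_nonneg (n : ℕ) : 0 ≤ controlWeight n := by
  rw [controlWeight, sub_nonneg, div_le_one (by positivity)]
  linarith [n.cast_nonneg (α := ℝ)]

theorem controlWeight_lt_one (n : ℕ) : controlWeight n < 1 :=
  sub_lt_self _ (by positivity)

/-- This limit is forced: weak-star continuity at 0 makes the control points tend to δ_∞, and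
testing on the constant 1 gives the weights. It also makes the norm bound continuous at 0. -/
theorem tendsto_controlWeight : Tendsto controlWeight atTop (𝓝 1) := by
  have h := (tendsto_add_atTop_iff_nat 1).2 (tendsto_one_div_add_atTop_nhds_zero_nat (𝕜 := ℝ))
  have h2 := h.const_sub 1
  rw [sub_zero] at h2
  refine h2.congr fun n => ?_
  rw [controlWeight]
  push_cast
  ring_nf

/-- The middle control point between `δ_{n+1}` and `δ_n`. -/
noncomputable def controlPoint (n : ℕ) : MeasureSpaceDual (OnePoint ℕ) :=
  controlWeight n • diracFunctional (n : OnePoint ℕ)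

theorem norm_controlPoint_le (n : ℕ) : ‖controlPoint n‖ ≤ controlWeight n :=
  ContinuousLinearMap.opNorm_le_bound _ (controlWeight_nonneg n) fun f => by
    change |controlWeight n * f n| ≤ _
    rw [abs_mul, abs_of_nonneg (controlWeight_nonneg n)]
    exact mul_le_mul_of_nonneg_left (f.norm_coe_le_norm n) (controlWeight_nonneg n)

/-- The curve of measures from `δ_∞` through the points `δ_n`. -/
noncomputable def measureCurve : I → MeasureSpaceDual (OnePoint ℕ) :=
  glueCurves (diracFunctional OnePoint.infty) fun n =>
    quadBezier (diracFunctional ((n + 1 : ℕ) : OnePoint ℕ)) (controlPoint n)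
      (diracFunctional (n : OnePoint ℕ))

theorem measureCurve_eq {n : ℕ} {t : I} {s : ℝ} (hs : s ∈ Icc (0 : ℝ) 1)
    (ht : (t : ℝ) = (1 - s) * (1 / ((n : ℝ) + 2)) + s * (1 / ((n : ℝ) + 1))) :
    measureCurve t = quadBezier (diracFunctional ((n + 1 : ℕ) : OnePoint ℕ)) (controlPoint n)
      (diracFunctional (n : OnePoint ℕ)) s :=
  glueCurves_eq (fun n => by rw [quadBezier_zero, quadBezier_one]) hs ht

theorem measureCurve_zero : measureCurve 0 = diracFunctional OnePoint.infty :=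
  glueCurves_zero _ _

theorem measureCurve_one_div {n : ℕ} {t : I} (ht : (t : ℝ) = 1 / ((n : ℝ) + 1)) :
    measureCurve t = diracFunctional (n : OnePoint ℕ) := by
  rw [measureCurve_eq (s := 1) (by simp) (by simpa using ht), quadBezier_one]

/-- Evaluation at `f` gives a real glued curve whose control points all tend to `f ∞`. In norm the
Dirac measures do not converge, so continuity holds only weak-star. -/
theorem continuous_measureCurve_apply (f : C(OnePoint ℕ, ℝ)) :
    Continuous fun t => measureCurve t f := by
  have h := tendsto_apply_infty f
  have h2 := tendsto_controlWeight.mul h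
  rw [one_mul] at h2
  refine (continuous_glueCurves_quadBezier h h2).congr fun t => ?_
  exact (map_glueCurves (fun μ : MeasureSpaceDual (OnePoint ℕ) => μ f)
    (diracFunctional OnePoint.infty) (fun n =>
      quadBezier (diracFunctional ((n + 1 : ℕ) : OnePoint ℕ)) (controlPoint n)
        (diracFunctional (n : OnePoint ℕ))) t).symm

/-- A continuous bound for the norms along `measureCurve`. -/
noncomputable def measureCurveBound : I → ℝ :=
  glueCurves 1 fun n => quadBezier 1 (controlWeight n) 1

theorem continuous_measureCurveBound : Continuous measureCurveBound :=
  continuous_glueCurves_quadBezier (a := fun _ => (1 : ℝ)) tendsto_const_nhds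
    tendsto_controlWeight

/-- For `w < 1` the deficit from 1 vanishes only at the ends of the piece, which confines the set
where the bound equals 1 to S. -/
theorem quadBezier_one_left_right (w s : ℝ) :
    quadBezier 1 w 1 s = 1 - 2 * (s * (1 - s)) * (1 - w) := by
  simp only [quadBezier, smul_eq_mul]
  ring

theorem measureCurveBound_le_one (t : I) : measureCurveBound t ≤ 1 := by
  rcases glueCurves_cases 1 (fun n => quadBezier 1 (controlWeight n) 1) t with
    ⟨-, h⟩ | ⟨n, s, hs, -, h⟩
  · exact h.le
  · rw [measureCurveBound, h, quadBezier_one_left_right]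
    exact sub_le_self _ (mul_nonneg (mul_nonneg zero_le_two
      (mul_nonneg hs.1 (sub_nonneg.2 hs.2))) (sub_nonneg.2 (controlWeight_lt_one n).le))

theorem eq_zero_or_one_div_of_measureCurveBound_eq_one {t : I} (ht : measureCurveBound t = 1) :
    t = 0 ∨ ∃ n : ℕ, (t : ℝ) = 1 / ((n : ℝ) + 1) := by
  rcases glueCurves_cases 1 (fun n => quadBezier 1 (controlWeight n) 1) t with
    ⟨h, -⟩ | ⟨n, s, hs, hts, h⟩
  · exact Or.inl h
  · rw [measureCurveBound, h, quadBezier_one_left_right] at ht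
    have h0 : s * (1 - s) = 0 := by
      have h1 : (s * (1 - s)) * (1 - controlWeight n) = 0 := by linarith
      exact (mul_eq_zero.1 h1).resolve_right (sub_pos.2 (controlWeight_lt_one n)).ne'
    rcases mul_eq_zero.1 h0 with h0 | h0
    · refine Or.inr ⟨n + 1, ?_⟩
      rw [hts, h0]
      push_cast
      ring
    · obtain rfl : s = 1 := by linarith
      exact Or.inr ⟨n, by rw [hts]; ring⟩

theorem norm_measureCurve_le (t : I) : ‖measureCurve t‖ ≤ measureCurveBound t := by
  by_cases ht : (t : ℝ) = 0
  · simp only [measureCurve, measureCurveBound, glueCurves, if_pos ht]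
    exact norm_diracFunctional_le _
  · obtain ⟨n, -, h1, h2⟩ := exists_affine_param ht
    have hs := affine_param_mem_Icc h1 h2
    have hts := (affine_param_iff n t _).2 rfl
    rw [measureCurve_eq hs hts, measureCurveBound,
      glueCurves_eq (fun n => by rw [quadBezier_zero, quadBezier_one]) hs hts]
    exact norm_quadBezier_le (V := MeasureSpaceDual (OnePoint ℕ)) (norm_diracFunctional_le _)
      (norm_controlPoint_le n)
      (norm_diracFunctional_le _) hs

/-! ### The embedding -/

/-- The embedding `x ↦ (t ↦ ⟨x, F t⟩)` of `c` into `C[0, 1]`, where `F` is `measureCurve`. -/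
noncomputable def curveEmbedding : ConvSeq →ₗᵢ[ℝ] C(I, ℝ) where
  toFun x := ⟨fun t => measureCurve t (convSeqEquiv x), continuous_measureCurve_apply _⟩
  map_add' x y := by ext t; simp
  map_smul' a x := by ext t; simp
  norm_map' x := by
    apply le_antisymm
    · rw [ContinuousMap.norm_le _ (norm_nonneg x)]
      intro t
      refine ((measureCurve t).le_of_opNorm_le
        ((norm_measureCurve_le t).trans (measureCurveBound_le_one t)) _).trans_eq ?_
      rw [one_mul, convSeqEquiv.norm_map]
    · rw [ConvSeq.norm_le (norm_nonneg _)]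
      intro n
      have hmem : 1 / ((n : ℝ) + 1) ∈ I := by
        refine ⟨by positivity, ?_⟩
        rw [div_le_one (by positivity)]
        linarith [n.cast_nonneg (α := ℝ)]
      refine Eq.trans_le ?_ (ContinuousMap.norm_coe_le_norm _ (⟨_, hmem⟩ : I))
      change _ = |measureCurve ⟨_, hmem⟩ (convSeqEquiv x)|
      rw [measureCurve_one_div rfl, ← convSeqEquiv_apply]
      rfl

theorem curveEmbedding_apply (x : ConvSeq) (t : I) :
    curveEmbedding x t = measureCurve t (convSeqEquiv x) :=
  rfl

/-- Every continuous function on `[0, 1]` agrees with one in the range of `curveEmbedding` at the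
points `0` and `1 / (n + 1)`. -/
theorem exists_curveEmbedding_eq (g : C(I, ℝ)) :
    ∃ x, ∀ t, measureCurveBound t = 1 → curveEmbedding x t = g t := by
  have hmem (n : ℕ) : 1 / ((n : ℝ) + 1) ∈ I := by
    refine ⟨by positivity, ?_⟩
    rw [div_le_one (by positivity)]
    linarith [n.cast_nonneg (α := ℝ)]
  have hlim : Tendsto (fun n : ℕ => g ⟨_, hmem n⟩) atTop (𝓝 (g 0)) :=
    (g.continuous.tendsto 0).comp
      (tendsto_subtype_rng.2 tendsto_one_div_add_atTop_nhds_zero_nat)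
  refine ⟨restrictToNat (OnePoint.continuousMapMkNat _ _ hlim), fun t ht => ?_⟩
  rw [curveEmbedding_apply, convSeqEquiv_restrictToNat]
  rcases eq_zero_or_one_div_of_measureCurveBound_eq_one ht with rfl | ⟨n, hn⟩
  · rw [measureCurve_zero]
    rfl
  · rw [measureCurve_one_div hn]
    exact congrArg g (Subtype.ext hn.symm)

theorem isUEmbedding_curveEmbedding : IsUEmbedding (X := ConvSeq) (Y := C(I, ℝ))
    curveEmbedding := by
  refine isUEmbedding_of_norm_le (X := ConvSeq) (K := I) continuous_measureCurveBound
    (fun t => (norm_nonneg (measureCurve t)).trans (norm_measureCurve_le t))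
    measureCurveBound_le_one
    (fun x t => ?_) exists_curveEmbedding_eq
  rw [← convSeqEquiv.norm_map x]
  exact (measureCurve t).le_of_opNorm_le (norm_measureCurve_le t) _

theorem mainTheorem10 :
    ¬ IsPolyhedralSpace ConvSeq ∧
    ∃ T : ConvSeq →ₗᵢ[ℝ] C(I, ℝ), IsUEmbedding (X := ConvSeq) (Y := C(I, ℝ)) T ∧
      ∃ (e : ConvSeq ≃ₗᵢ[ℝ] C(OnePoint ℕ, ℝ))
        (F : I → MeasureSpaceDual (OnePoint ℕ))
        (p : ℕ → MeasureSpaceDual (OnePoint ℕ)),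
        -- `e` is the canonical identification of `c` with `C(ℕ ∪ {∞})`
        (∀ (x : ConvSeq) (n : ℕ), e x (n : OnePoint ℕ) = x.1 n) ∧
        -- `F` is a weak-star continuous map into the unit ball, and `T` is the operator `T_F`
        Continuous (fun t => StrongDual.toWeakDual (F t)) ∧
        (∀ t, ‖F t‖ ≤ 1) ∧
        (∀ (x : ConvSeq) (t : I), T x t = F t (e x)) ∧
        -- the values of `F`; the index `n : ℕ` starts at `0` and stands for the point `1 / (n + 1)`
        F 0 = diracFunctional (OnePoint.infty : OnePoint ℕ) ∧
        (∀ (n : ℕ) (t : I), (t : ℝ) = 1 / ((n : ℝ) + 1) →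
          F t = diracFunctional (n : OnePoint ℕ)) ∧
        -- between consecutive points `1 / (n + 2)` and `1 / (n + 1)` it runs a Bézier curve
        (∀ n, ‖p n‖ < 1) ∧
        (∀ (n : ℕ) (t : I) (s : ℝ), s ∈ Set.Icc (0 : ℝ) 1 →
          (t : ℝ) = (1 - s) * (1 / ((n : ℝ) + 2)) + s * (1 / ((n : ℝ) + 1)) →
          F t = quadBezier (diracFunctional ((n + 1 : ℕ) : OnePoint ℕ)) (p n)
            (diracFunctional (n : OnePoint ℕ)) s) := by
  refine ⟨not_isPolyhedralSpace_convSeq, curveEmbedding, isUEmbedding_curveEmbedding,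
    convSeqEquiv, measureCurve, controlPoint, convSeqEquiv_apply, ?_, fun t => ?_,
    curveEmbedding_apply, measureCurve_zero, fun n t => measureCurve_one_div, fun n => ?_,
    fun n t s => measureCurve_eq⟩
  · exact WeakDual.continuous_of_continuous_eval continuous_measureCurve_apply
  · exact (norm_measureCurve_le t).trans (measureCurveBound_le_one t)
  · exact (norm_controlPoint_le n).trans_lt (controlWeight_lt_one n)
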